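/- Setting. There are $N\ge 1$ products $\mathcal N=\{1,\dots,N\}$ and purchase options $\mathcal N^+=\{0,1,\dots,N\}$, where $0$ is the no-purchase option; an assortment is a subset of $\mathcal N$. A purchase decision tree is a binary tree in which every non-leaf node (split) carries a product and every leaf carries either the option $0$ or the product of a split that has the leaf in its left subtree. Given an assortment $S$, the customer starts at the root, moves to the left child if the product of the current split lies in $S$ and to the right child otherwise, and takes the option of the leaf that is reached. A single leaf has depth $1$; in general the depth of a tree is $1$ plus the largest number of edges from the root to a leaf. A forest $F$ is a nonempty finite set of such trees, and its depth is the largest depth of its trees. For a probability distribution $\lambda$ on $F$, let $\mathbf P^{(F,\lambda)}(o\mid S)$ be the $\lambda$-probability of the trees of $F$ that choose $o$ from $S$. Choice data on assortments $S_1,\dots,S_M$ assign to each assortment $S$ in the collection a probability distribution $(v_{o,S})_{o\in\mathcal N^+}$ with $v_{o,S}=0$ for $o\notin S\cup\{0\}$. Say that $S_1,\dots,S_M$ can be fitted at depth $d$ if there is a forest $F$ of depth $d$ such that for all choice data there is a distribution $\lambda$ on $F$ with $\mathbf P^{(F,\lambda)}(o\mid S_m)=v_{o,S_m}$ for all $m$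 and all $o\in\mathcal N^+$. Theorem. (a) There are absolute constants $C,K,D>0$ such that for all $N\ge1$ and $M\ge2$ there is a depth $d\le D\log_2 M$ with the following property: if $S_1,\dots,S_M$ are drawn independently and uniformly from all $2^N$ assortments, then with probability at least $$1-K\,M^2\,2^{-CN/\log_2 M}$$ they can be fitted at depth $d$. (b) Let $N\ge 1$, $\epsilon\in(0,1)$, and let $1\le M_0<M$ be integers. Put $k=\epsilon^2/(2(2-\epsilon)^2)$, $\bar d=\lceil\log_{2-\epsilon}(M/M_0)\rceil$ and $q=\lfloor N/\bar d\rfloor$. For every $M'\le M$, if $S_1,\dots,S_{M'}$ are drawn independently and uniformly from all $2^N$ assortments, then the probability that they cannot be fitted at depth $\bar d+M_0+1$ is at most $$(2^{\bar d}-1)\cdot 2^{-q(kM_0-1)}.$$ -/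

import Mathlib

open MeasureTheory

/-- An assortment over the universe `Fin N` of `N` products. -/
abbrev Assortment (N : ℕ) : Type := Finset (Fin N)

/-- A purchase option: `none` is the no-purchase option, `some p` is the purchase of `p`. -/
abbrev PurchaseOption (N : ℕ) : Type := Option (Fin N)

/-- Every set of assortments is an event. -/
instance Assortment.measurableSpace (N : ℕ) : MeasurableSpace (Assortment N) := ⊤

/-- Binary trees whose split nodes carry products and whose leaves carry purchase options. -/
inductive PurchaseTree (N : ℕ) : Type
  | leaf (o : PurchaseOption N) : PurchaseTree N
  | split (p : Fin N) (left right : PurchaseTree N) : PurchaseTree N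

namespace PurchaseTree

variable {N : ℕ}

/-- The decision of a customer following the tree: go left at a split if its product is in the
assortment and right otherwise, and take the option of the leaf that is reached. -/
def decision (S : Assortment N) : PurchaseTree N → PurchaseOption N
  | leaf o => o
  | split p l r => if p ∈ S then l.decision S else r.decision S

/-- Each leaf carries the no-purchase option, or a product of `seen`, or the product of a split
that has the leaf in its left subtree. -/
def WellDefinedFrom (seen : Finset (Fin N)) : PurchaseTree N → Prop
  | leaf o => o = none ∨ ∃ p ∈ seen, o = some p
  | split p l r => l.WellDefinedFrom (insert p seen) ∧ r.WellDefinedFrom seen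

/-- The tree is a purchase decision tree: the option of each leaf is the no-purchase option or
the product of a split that has the leaf in its left subtree. -/
def IsDecisionTree (t : PurchaseTree N) : Prop := t.WellDefinedFrom ∅

/-- The depth; a single leaf has depth `1`. -/
def depth : PurchaseTree N → ℕ
  | leaf _ => 1
  | split _ l r => max l.depth r.depth + 1

end PurchaseTree

/-- A decision forest: a nonempty finite collection of purchase decision trees. -/
structure DecisionForest (N : ℕ) where
  trees : Finset (PurchaseTree N)
  nonempty : trees.Nonempty
  isDecisionTree : ∀ t ∈ trees, t.IsDecisionTree

namespace DecisionForest

variable {N : ℕ}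

/-- The largest depth of a tree of the forest. -/
def depth (F : DecisionForest N) : ℕ := F.trees.sup PurchaseTree.depth

/-- `lam` is a probability distribution over the trees of the forest. -/
def IsDistribution (F : DecisionForest N) (lam : PurchaseTree N → ℝ) : Prop :=
  (∀ t ∈ F.trees, 0 ≤ lam t) ∧ ∑ t ∈ F.trees, lam t = 1

/-- The probability that the decision forest model `(F, lam)` gives to option `o` when the
assortment `S` is offered. -/
noncomputable def choiceProb (F : DecisionForest N) (lam : PurchaseTree N → ℝ)
    (o : PurchaseOption N) (S : Assortment N) : ℝ :=
  ∑ t ∈ F.trees, lam t * (if o = t.decision S then 1 else 0)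

end DecisionForest

/-- `w` is a probability distribution over the purchase options that gives probability zero to
every product outside the offered assortment `S`. -/
def IsChoiceDistribution {N : ℕ} (S : Assortment N) (w : PurchaseOption N → ℝ) : Prop :=
  (∀ o, 0 ≤ w o) ∧ ∑ o, w o = 1 ∧ ∀ p, p ∉ S → w (some p) = 0

/-- Some forest of depth `d` fits any choice data on the assortments `S 0, …, S (M - 1)` exactly:
for all choice probabilities `v (S m)` of these assortments there is a probability distribution
over the trees of the forest that reproduces them. -/
def FitsAtDepth {N M : ℕ} (S : Fin M → Assortment N) (d : ℕ) : Prop :=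
  ∃ F : DecisionForest N, F.depth = d ∧
    ∀ v : Assortment N → PurchaseOption N → ℝ, (∀ m, IsChoiceDistribution (S m) (v (S m))) →
      ∃ lam : PurchaseTree N → ℝ, F.IsDistribution lam ∧
        ∀ m o, F.choiceProb lam o (S m) = v (S m) o

/-- The uniform distribution on all `2 ^ N` assortments. -/
noncomputable def assortmentLaw (N : ℕ) : Measure (Assortment N) :=
  (PMF.uniformOfFintype (Assortment N)).toMeasure

/-- The law of `M` independent uniformly distributed assortments. -/
noncomputable def drawLaw (N M : ℕ) : Measure (Fin M → Assortment N) :=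
  Measure.pi fun _ => assortmentLaw N

/-- `⌈log_{2 - ε} (M / M₀)⌉`; only used for `0 < ε < 1` and `0 < M₀ < M`, where it is positive. -/
noncomputable def splitLevels (M M₀ : ℕ) (ε : ℝ) : ℕ :=
  ⌈Real.logb (2 - ε) ((M : ℝ) / (M₀ : ℝ))⌉₊

/-! It suffices that some tree of small depth follows each deterministic choice rule on the drawn
assortments (`TreeRealizable`). Given choice data, let each distinct assortment choose independently
from its prescribed distribution: this is a product measure on rules, its marginals are the data,
and each rule in its support is followed by a tree of the forest (`fitsAtDepth_of_treeRealizable`).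
Rules can be followed once splits isolate the assortments.

For (a), about `2 log₂ M` fixed products separate all pairs with probability at least 1/2, and
disjoint blocks of products give independent attempts. For (b), level `l` of the tree splits on a
product from its own block of `q`. By Hoeffding some product of the block cuts the current set into
parts smaller by a factor `2 - ε`. Blocks used later are independent of the sets formed so far, so a
union bound over the `2 ^ dbar - 1` internal nodes applies. Parts of at most `M₀` assortments are
then separated one by one. -/

/-! ### Trees that follow deterministic choice rules. -/

namespace PurchaseTree

variable {N : ℕ}

theorem WellDefinedFrom.mono {t : PurchaseTree N} {s s' : Finset (Fin N)}
    (h : t.WellDefinedFrom s) (hs : s ⊆ s') : t.WellDefinedFrom s' := by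
  induction t generalizing s s' with
  | leaf o =>
    rcases h with h | ⟨p, hp, h⟩
    · exact Or.inl h
    · exact Or.inr ⟨p, hs hp, h⟩
  | split p l r hl hr =>
    exact ⟨hl h.1 (Finset.insert_subset_insert _ hs), hr h.2 hs⟩

theorem exists_isDecisionTree_depth_eq (p : Fin N) (n : ℕ) :
    ∃ t : PurchaseTree N, t.IsDecisionTree ∧ t.depth = n + 1 := by
  induction n with
  | zero => exact ⟨leaf none, Or.inl rfl, rfl⟩
  | succ n ih =>
    obtain ⟨t, ht, hd⟩ := ih
    exact ⟨split p t t, ⟨ht.mono (Finset.empty_subset _), ht⟩, by simp [depth, hd]⟩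

end PurchaseTree

/-- Every deterministic choice rule that picks an available option from each assortment is
followed on `A` by some purchase decision tree of depth at most `d`. -/
def TreeRealizable {N : ℕ} (A : Finset (Assortment N)) (d : ℕ) : Prop :=
  ∀ f : Assortment N → PurchaseOption N, (∀ S p, f S = some p → p ∈ S) →
    ∃ t : PurchaseTree N, t.IsDecisionTree ∧ t.depth ≤ d ∧ ∀ S ∈ A, t.decision S = f S

namespace TreeRealizable

variable {N : ℕ} {A : Finset (Assortment N)} {d d' : ℕ}

theorem mono (h : TreeRealizable A d) (hd : d ≤ d') : TreeRealizable A d' := by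
  intro f hf
  obtain ⟨t, h1, h2, h3⟩ := h f hf
  exact ⟨t, h1, h2.trans hd, h3⟩

/-- Depth 2 is needed because a leaf may carry `p` only to the left of a split on `p`. -/
theorem of_card_le_one (h : A.card ≤ 1) : TreeRealizable A 2 := by
  intro f hf
  rcases Finset.card_le_one_iff_subset_singleton (s := A) |>.1 h with ⟨S, hS⟩
  rcases hfS : f S with _ | p
  · refine ⟨.leaf none, Or.inl rfl, by simp [PurchaseTree.depth], fun T hT => ?_⟩
    rw [Finset.mem_singleton.1 (hS hT), hfS]; rfl
  · refine ⟨.split p (.leaf (some p)) (.leaf none),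
      ⟨Or.inr ⟨p, by simp, rfl⟩, Or.inl rfl⟩, by simp [PurchaseTree.depth], fun T hT => ?_⟩
    rw [Finset.mem_singleton.1 (hS hT), hfS]
    simp [PurchaseTree.decision, hf S p hfS]

theorem of_split (p : Fin N) (hl : TreeRealizable (A.filter (p ∈ ·)) d)
    (hr : TreeRealizable (A.filter (p ∉ ·)) d) : TreeRealizable A (d + 1) := by
  intro f hf
  obtain ⟨l, l1, l2, l3⟩ := hl f hf
  obtain ⟨r, r1, r2, r3⟩ := hr f hf
  refine ⟨.split p l r, ⟨l1.mono (Finset.empty_subset _), r1⟩, ?_, fun S hS => ?_⟩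
  · simp [PurchaseTree.depth, l2, r2]
  · by_cases h : p ∈ S
    · simpa [PurchaseTree.decision, h] using l3 S (by simp [hS, h])
    · simpa [PurchaseTree.decision, h] using r3 S (by simp [hS, h])

/-- A product on which two members of `A` differ leaves both sides nonempty, so each split removes
at least one assortment. -/
theorem of_card_le (n : ℕ) : ∀ A : Finset (Assortment N), A.card ≤ n + 1 →
    TreeRealizable A (n + 2) := by
  induction n with
  | zero => exact fun A h => of_card_le_one h
  | succ n ih =>
    intro A h
    by_cases h1 : A.card ≤ 1
    · exact (of_card_le_one h1).mono (by omega)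
    obtain ⟨S, hS, T, hT, hST⟩ := Finset.one_lt_card.1 (not_le.1 h1)
    have key : ∃ p, ∃ U ∈ A, ∃ V ∈ A, p ∈ U ∧ p ∉ V := by
      by_contra! hc
      exact hST (Finset.ext fun p => ⟨fun hp => hc p S hS T hT hp, fun hp => hc p T hT S hS hp⟩)
    obtain ⟨p, U, hU, V, hV, hpU, hpV⟩ := key
    have hlt : (A.filter (p ∈ ·)).card < A.card :=
      Finset.card_lt_card (Finset.filter_ssubset.2 ⟨V, hV, hpV⟩)
    have hlt' : (A.filter (p ∉ ·)).card < A.card :=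
      Finset.card_lt_card (Finset.filter_ssubset.2 ⟨U, hU, not_not.2 hpU⟩)
    exact of_split p (ih _ (by omega)) (ih _ (by omega))

theorem of_separated (l : List (Fin N)) : ∀ A : Finset (Assortment N),
    (∀ S ∈ A, ∀ T ∈ A, (∀ p ∈ l, p ∈ S ↔ p ∈ T) → S = T) → TreeRealizable A (l.length + 2) := by
  induction l with
  | nil =>
    intro A h
    exact of_card_le_one (Finset.card_le_one.2 fun S hS T hT => h S hS T hT (by simp))
  | cons p l ih =>
    intro A h
    refine of_split p (ih _ fun S hS T hT hl => ?_) (ih _ fun S hS T hT hl => ?_) <;>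
    · rw [Finset.mem_filter] at hS hT
      refine h S hS.1 T hT.1 fun r hr => ?_
      rcases List.mem_cons.1 hr with rfl | hr
      · simp [hS.2, hT.2]
      · exact hl r hr

end TreeRealizable

/-! ### From deterministic rules to arbitrary choice data. -/

theorem sum_pi_prod {ι α : Type*} [Fintype ι] [DecidableEq ι] [Fintype α] (w : ι → α → ℝ) :
    ∑ f : ι → α, ∏ i, w i (f i) = ∏ i, ∑ a, w i a := by
  rw [Finset.prod_univ_sum, Fintype.piFinset_univ]

theorem sum_pi_prod_marginal {ι α : Type*} [Fintype ι] [DecidableEq ι] [Fintype α]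
    [DecidableEq α] (w : ι → α → ℝ) (hw : ∀ i, ∑ a, w i a = 1) (j : ι) (a : α) :
    ∑ f : ι → α, (∏ i, w i (f i)) * (if a = f j then 1 else 0) = w j a := by
  -- The indicator is absorbed into the factor at `j`, so the sum factorizes.
  have h : ∀ f : ι → α, (∏ i, w i (f i)) * (if a = f j then 1 else 0) =
      ∏ i, (w i (f i) * if i = j then (if a = f i then 1 else 0) else 1) := by
    intro f
    rw [Finset.prod_mul_distrib, Finset.prod_ite_eq']
    simp
  simp_rw [h]
  rw [sum_pi_prod (fun i b => w i b * if i = j then (if a = b then 1 else 0) else 1),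
    Finset.prod_eq_single j]
  · simp
  · intro i _ hi
    simp [hi, hw]
  · simp

theorem fitsAtDepth_of_treeRealizable {N M d : ℕ} (hN : 1 ≤ N) (S : Fin M → Assortment N)
    (h : TreeRealizable (Finset.univ.image S) (d + 1)) : FitsAtDepth S (d + 1) := by
  classical
  set A := Finset.univ.image S with hA
  -- `t₀` makes the depth of the forest exactly `d + 1`; it also stands in for rules that choose
  -- unavailable products.
  obtain ⟨t₀, ht₀, hd₀⟩ := PurchaseTree.exists_isDecisionTree_depth_eq (⟨0, hN⟩ : Fin N) d
  have key : ∀ f : A → PurchaseOption N, ∃ t : PurchaseTree N, t.IsDecisionTree ∧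
      t.depth ≤ d + 1 ∧ ((∀ T : A, ∀ p, f T = some p → p ∈ T.1) → ∀ T : A, t.decision T.1 = f T) := by
    intro f
    by_cases hf : ∀ T : A, ∀ p, f T = some p → p ∈ T.1
    · obtain ⟨t, h1, h2, h3⟩ := h (fun T => if hT : T ∈ A then f ⟨T, hT⟩ else none) (by
        intro T p hp
        split_ifs at hp with hT
        exact hf ⟨T, hT⟩ p hp)
      refine ⟨t, h1, h2, fun _ T => ?_⟩
      rw [h3 T.1 T.2, dif_pos T.2]
    · exact ⟨t₀, ht₀, hd₀.le, fun h => absurd h hf⟩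
  choose t ht1 ht2 ht3 using key
  refine ⟨⟨insert t₀ (Finset.univ.image t), by simp, ?_⟩, ?_, ?_⟩
  · simpa using ⟨ht₀, ht1⟩
  · refine le_antisymm (Finset.sup_le ?_) ?_
    · simpa using ⟨hd₀.le, ht2⟩
    · exact hd₀.ge.trans (Finset.le_sup (f := PurchaseTree.depth) (Finset.mem_insert_self _ _))
  intro v hv
  have hvA : ∀ T : A, IsChoiceDistribution T.1 (v T.1) := by
    rintro ⟨T, hT⟩
    obtain ⟨m, -, rfl⟩ := Finset.mem_image.1 hT
    exact hv m
  have hw0 : ∀ f : A → PurchaseOption N, 0 ≤ ∏ T : A, v T.1 (f T) := fun f =>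
    Finset.prod_nonneg fun T _ => (hvA T).1 _
  -- The product measure is pushed forward along `t`, since several rules may share a tree.
  refine ⟨fun u => ∑ f : A → PurchaseOption N,
    if t f = u then ∏ T : A, v T.1 (f T) else 0, ⟨?_, ?_⟩, ?_⟩
  · exact fun u _ => Finset.sum_nonneg fun f _ => by
      split_ifs
      exacts [hw0 f, le_rfl]
  · rw [Finset.sum_comm]
    have : ∀ f : A → PurchaseOption N, (∑ u ∈ insert t₀ (Finset.univ.image t),
        if t f = u then ∏ T : A, v T.1 (f T) else 0) = ∏ T : A, v T.1 (f T) := by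
      intro f
      rw [Finset.sum_ite_eq, if_pos]
      simp
    simp_rw [this]
    rw [sum_pi_prod (fun T : A => v T.1)]
    exact Finset.prod_eq_one fun T _ => (hvA T).2.1
  · intro m o
    have hm : S m ∈ A := by simp [hA]
    simp only [DecisionForest.choiceProb, Finset.sum_mul]
    rw [Finset.sum_comm]
    have : ∀ f : A → PurchaseOption N, (∑ u ∈ insert t₀ (Finset.univ.image t),
        (if t f = u then ∏ T : A, v T.1 (f T) else 0) *
          (if o = u.decision (S m) then 1 else 0)) =
        (∏ T : A, v T.1 (f T)) * (if o = f ⟨S m, hm⟩ then 1 else 0) := by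
      intro f
      simp_rw [ite_mul, zero_mul]
      rw [Finset.sum_ite_eq, if_pos (by simp)]
      by_cases hf : ∀ T : A, ∀ p, f T = some p → p ∈ T.1
      · rw [ht3 f hf ⟨S m, hm⟩]
      -- A rule choosing an unavailable product has weight zero, so its tree is irrelevant.
      · push Not at hf
        obtain ⟨T, p, hp, hpT⟩ := hf
        rw [Finset.prod_eq_zero (Finset.mem_univ T) (by rw [hp]; exact (hvA T).2.2 p hpT)]
        simp
    simp_rw [this]
    exact sum_pi_prod_marginal (fun T : A => v T.1) (fun T => (hvA T).2.1) ⟨S m, hm⟩ o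
-- Uniform probability on finite types as an average.
open scoped BigOperators

open Classical in
/-- The probability of `E` under the uniform distribution on a finite type. -/
noncomputable def uniformProb {Ω : Type*} [Fintype Ω] (E : Ω → Prop) : ℝ :=
  𝔼 x, if E x then 1 else 0

section UniformProb

variable {Ω Ω' ι κ Y : Type*} [Fintype Ω] [Fintype Ω'] [Fintype ι] [Fintype κ] [Fintype Y]

theorem uniformProb_mono {E E' : Ω → Prop} (h : ∀ x, E x → E' x) :
    uniformProb E ≤ uniformProb E' := by
  refine Finset.expect_le_expect fun x _ => ?_
  by_cases hx : E x
  · simp [hx, h x hx]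
  · rw [if_neg hx]
    split_ifs <;> simp

theorem uniformProb_le_one (E : Ω → Prop) : uniformProb E ≤ 1 := by
  rcases isEmpty_or_nonempty Ω with h | h
  · simp [uniformProb]
  · exact (Finset.expect_le_expect (fun x _ => by split_ifs <;> simp)).trans
      (Fintype.expect_const (1 : ℝ)).le

theorem uniformProb_nonneg (E : Ω → Prop) : 0 ≤ uniformProb E :=
  Finset.expect_nonneg fun x _ => by split_ifs <;> simp

theorem uniformProb_or_le (E E' : Ω → Prop) :
    uniformProb (fun x => E x ∨ E' x) ≤ uniformProb E + uniformProb E' := by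
  unfold uniformProb
  rw [← Finset.expect_add_distrib]
  refine Finset.expect_le_expect fun x _ => ?_
  by_cases h : E x <;> by_cases h' : E' x <;> simp [h, h']

theorem uniformProb_equiv (e : Ω ≃ Ω') (E : Ω → Prop) :
    uniformProb E = uniformProb (fun y => E (e.symm y)) :=
  Fintype.expect_equiv e _ _ fun x => by
    congr 1
    exact congrArg E (e.symm_apply_apply x).symm

theorem expect_prod (f : Ω × Ω' → ℝ) : 𝔼 x, f x = 𝔼 a, 𝔼 b, f (a, b) := by
  rw [← Finset.univ_product_univ, Finset.expect_product]

theorem uniformProb_prod (E : Ω × Ω' → Prop) :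
    uniformProb E = 𝔼 a, uniformProb (fun b => E (a, b)) := expect_prod _

theorem expect_pi_prod [DecidableEq ι] (w : ι → Y → ℝ) :
    𝔼 f : ι → Y, ∏ i, w i (f i) = ∏ i, 𝔼 y, w i y := by
  simp_rw [Fintype.expect_eq_sum_div_card]
  rw [sum_pi_prod, Finset.prod_div_distrib]
  simp

theorem uniformProb_forall [DecidableEq ι] (E : ι → Y → Prop) :
    uniformProb (fun f : ι → Y => ∀ i, E i (f i)) = ∏ i, uniformProb (E i) := by
  classical
  unfold uniformProb
  rw [← expect_pi_prod (fun i y => if E i y then (1 : ℝ) else 0)]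
  refine Finset.expect_congr rfl fun f _ => ?_
  rw [Finset.prod_boole]
  simp

theorem uniformProb_fin_succ {n : ℕ} (E : (Fin (n + 1) → Y) → Prop) :
    uniformProb E = 𝔼 y, uniformProb (fun f : Fin n → Y => E (Fin.cons y f)) := by
  rw [uniformProb_equiv (Fin.consEquiv fun _ => Y).symm, uniformProb_prod]
  rfl

/-- Coordinates outside the range of `e` average out. -/
theorem uniformProb_comp_injective [DecidableEq ι] [DecidableEq κ] [Nonempty Y] {e : ι → κ}
    (he : Function.Injective e) (E : (ι → Y) → Prop) :
    uniformProb (fun g : κ → Y => E (g ∘ e)) = uniformProb E := by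
  classical
  let σ : ι ⊕ ↥(Set.range e)ᶜ ≃ κ :=
    ((Equiv.ofInjective e he).sumCongr (Equiv.refl _)).trans (Equiv.Set.sumCompl (Set.range e))
  have hσ : ∀ i, σ (Sum.inl i) = e i := fun i => by simp [σ]
  rw [uniformProb_equiv ((σ.arrowCongr (Equiv.refl Y)).symm.trans (Equiv.sumArrowEquivProdArrow _ _ Y)),
    uniformProb_prod]
  have : ∀ (a : ι → Y) (b : ↥(Set.range e)ᶜ → Y),
      (((σ.arrowCongr (Equiv.refl Y)).symm.trans
        (Equiv.sumArrowEquivProdArrow _ _ Y)).symm (a, b)) ∘ e = a := by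
    intro a b
    funext i
    simp [← hσ]
  simp_rw [this]
  refine Finset.expect_congr rfl fun a _ => ?_
  exact Fintype.expect_const _

theorem uniformProb_compl [Nonempty Ω] (E : Ω → Prop) :
    uniformProb (fun x => ¬ E x) = 1 - uniformProb E := by
  classical
  unfold uniformProb
  rw [← Fintype.expect_one (ι := Ω), ← Finset.expect_sub_distrib]
  refine Finset.expect_congr rfl fun x _ => ?_
  by_cases h : E x <;> simp [h]

end UniformProb

theorem uniformProb_exists_le {Ω κ : Type*} [Fintype Ω] {s : Finset κ} (E : κ → Ω → Prop) :
    uniformProb (fun x => ∃ i ∈ s, E i x) ≤ ∑ i ∈ s, uniformProb (E i) := by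
  classical
  unfold uniformProb
  rw [← Finset.expect_sum_comm]
  refine Finset.expect_le_expect fun x _ => ?_
  split_ifs with h
  · obtain ⟨i, hi, hx⟩ := h
    refine le_trans ?_ (Finset.single_le_sum (f := fun i => if E i x then (1 : ℝ) else 0)
      (fun j _ => by split_ifs <;> simp) hi)
    simp [hx]
  · exact Finset.sum_nonneg fun j _ => by split_ifs <;> simp

/-! ### The law of the draws and its independent product columns. -/

instance (N : ℕ) : IsProbabilityMeasure (assortmentLaw N) := by
  unfold assortmentLaw; infer_instance

instance (N M : ℕ) : IsProbabilityMeasure (drawLaw N M) := by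
  unfold drawLaw; infer_instance

instance (N : ℕ) : DiscreteMeasurableSpace (Assortment N) := ⟨fun _ => trivial⟩

theorem drawLaw_real_eq_uniformProb (N M : ℕ) (E : (Fin M → Assortment N) → Prop) :
    (drawLaw N M).real {S | E S} = uniformProb E := by
  classical
  have h1 : ∀ S : Fin M → Assortment N,
      (drawLaw N M).real {S} = ((Fintype.card (Fin M → Assortment N) : ℝ))⁻¹ := by
    intro S
    rw [measureReal_def, drawLaw, Measure.pi_singleton]
    simp_rw [assortmentLaw, PMF.toMeasure_apply_singleton _ _ (measurableSet_singleton _),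
      PMF.uniformOfFintype_apply]
    simp
  have h2 : {S | E S} = ((Finset.univ.filter E : Finset (Fin M → Assortment N)) : Set _) := by
    ext; simp
  rw [h2, ← sum_measureReal_singleton]
  simp_rw [h1]
  rw [uniformProb, Fintype.expect_eq_sum_div_card, Finset.sum_boole, Finset.sum_const, nsmul_eq_mul,
    div_eq_mul_inv]

/-- Which of the drawn assortments contain the `i`-th product of the `g`-th of `a` disjoint blocks
of `b` products. -/
def blockColumns {N M a b : ℕ} (h : a * b ≤ N) (S : Fin M → Assortment N) :
    Fin a → Fin b → Fin M → Bool :=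
  fun g i m => decide (Fin.castLE h (finProdFinEquiv (g, i)) ∈ S m)

/-- Transposing the membership matrix turns independent uniform assortments into independent uniform
columns, one per product. -/
theorem uniformProb_blockColumns {N M a b : ℕ} (h : a * b ≤ N)
    (E : (Fin a → Fin b → Fin M → Bool) → Prop) :
    uniformProb (fun S : Fin M → Assortment N => E (blockColumns h S)) = uniformProb E := by
  classical
  let τ : (Fin M → Assortment N) ≃ (Fin N → Fin M → Bool) :=
    { toFun := fun S p m => decide (p ∈ S m)
      invFun := fun g m => Finset.univ.filter fun p => g p m = true
      left_inv := fun S => by ext; simp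
      right_inv := fun g => by ext; simp }
  rw [uniformProb_equiv τ]
  have he : Function.Injective (fun x : Fin a × Fin b => Fin.castLE h (finProdFinEquiv x)) :=
    (Fin.castLE_injective h).comp finProdFinEquiv.injective
  rw [uniformProb_equiv (Equiv.curry (Fin a) (Fin b) (Fin M → Bool)).symm E,
    ← uniformProb_comp_injective he]
  congr 1
  funext g
  congr 1
  funext x i m
  simp [blockColumns, τ]

/-! ### Part (a): separation by a fixed block of products. -/

section NonadaptiveSeparation

variable {M : ℕ}

theorem uniformProb_column_eq {m m' : Fin M} (h : m ≠ m') :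
    uniformProb (fun c : Fin M → Bool => c m = c m') = 1 / 2 := by
  -- Flipping the entry at `m` exchanges the event with its complement.
  have hinv : Function.Involutive (fun c : Fin M → Bool => Function.update c m (!c m)) := by
    intro c
    simp
  have h1 := uniformProb_equiv hinv.toPerm (fun c : Fin M → Bool => c m = c m')
  have h2 : (fun c : Fin M → Bool => (hinv.toPerm.symm c) m = (hinv.toPerm.symm c) m') =
      fun c => ¬ c m = c m' := by
    funext c
    have : hinv.toPerm.symm c = Function.update c m (!c m) := rfl
    rw [this, Function.update_self, Function.update_of_ne h.symm]
    cases c m <;> cases c m' <;> simp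
  rw [h2, uniformProb_compl] at h1
  linarith

theorem uniformProb_not_injective_le (d : ℕ) :
    uniformProb (fun h : Fin d → Fin M → Bool => ¬ Function.Injective fun m i => h i m) ≤
      (M : ℝ) ^ 2 * (1 / 2) ^ d := by
  classical
  have h1 : uniformProb (fun h : Fin d → Fin M → Bool => ¬ Function.Injective fun m i => h i m) ≤
      uniformProb (fun h : Fin d → Fin M → Bool =>
        ∃ x ∈ (Finset.univ : Finset (Fin M)).offDiag, ∀ i, h i x.1 = h i x.2) := by
    refine uniformProb_mono fun h hh => ?_
    obtain ⟨m, m', he, hne⟩ := Function.not_injective_iff.1 hh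
    exact ⟨(m, m'), by simp [hne], fun i => congrFun he i⟩
  refine h1.trans ((uniformProb_exists_le _).trans ?_)
  have h2 : ∀ x ∈ (Finset.univ : Finset (Fin M)).offDiag,
      uniformProb (fun h : Fin d → Fin M → Bool => ∀ i, h i x.1 = h i x.2) ≤ (1 / 2) ^ d := by
    intro x hx
    rw [uniformProb_forall (fun _ (c : Fin M → Bool) => c x.1 = c x.2),
      uniformProb_column_eq (Finset.mem_offDiag.1 hx).2.2]
    simp
  refine (Finset.sum_le_card_nsmul _ _ _ h2).trans ?_
  rw [nsmul_eq_mul]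
  gcongr
  rw [Finset.offDiag_card, Finset.card_univ, Fintype.card_fin, sq]
  exact_mod_cast Nat.sub_le _ _

theorem treeRealizable_of_injective {N d : ℕ} (S : Fin M → Assortment N) (e : Fin d → Fin N)
    (h : Function.Injective fun m i => decide (e i ∈ S m)) :
    TreeRealizable (Finset.univ.image S) (d + 2) := by
  have := TreeRealizable.of_separated (List.ofFn e) (Finset.univ.image S) (by
    intro A hA B hB hl
    obtain ⟨m, -, rfl⟩ := Finset.mem_image.1 hA
    obtain ⟨m', -, rfl⟩ := Finset.mem_image.1 hB
    refine congrArg S (h (funext fun i => ?_))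
    simpa using hl (e i) (by simp))
  simpa using this

/-- There are `N / d` disjoint blocks, and each independently fails to separate with probability at
most 1/2. -/
theorem uniformProb_not_fitsAtDepth_le {N d : ℕ} (hN : 1 ≤ N) (hd : 2 * (M : ℝ) ^ 2 ≤ 2 ^ d) :
    uniformProb (fun S : Fin M → Assortment N => ¬ FitsAtDepth S (d + 2)) ≤
      (1 / 2) ^ (N / d) := by
  have hle : N / d * d ≤ N := Nat.div_mul_le_self N d
  have h1 : uniformProb (fun S : Fin M → Assortment N => ¬ FitsAtDepth S (d + 2)) ≤
      uniformProb (fun S : Fin M → Assortment N =>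
        ∀ g, ¬ Function.Injective fun m i => blockColumns hle S g i m) := by
    refine uniformProb_mono fun S hS g hg => hS ?_
    exact fitsAtDepth_of_treeRealizable hN S (treeRealizable_of_injective S _ hg)
  rw [uniformProb_blockColumns hle (fun f => ∀ g, ¬ Function.Injective fun m i => f g i m),
    uniformProb_forall (fun _ (h : Fin d → Fin M → Bool) =>
      ¬ Function.Injective fun m i => h i m)] at h1
  refine h1.trans ?_
  rw [Finset.prod_const, Finset.card_univ, Fintype.card_fin]
  refine pow_le_pow_left₀ (uniformProb_nonneg _) ((uniformProb_not_injective_le d).trans ?_) _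
  rw [one_div, inv_pow, ← div_eq_mul_inv, div_le_iff₀ (by positivity)]
  linarith

theorem exists_fitsAtDepth_logarithmic (N M : ℕ) (hN : 1 ≤ N) (hM : 2 ≤ M) :
    ∃ d : ℕ, (d : ℝ) ≤ 6 * Real.logb 2 M ∧
      1 - 2 * ((M : ℝ) ^ 2 * (2 : ℝ) ^ (-(1 / 4 * (N : ℝ) / Real.logb 2 M))) ≤
        (drawLaw N M).real {S | FitsAtDepth S d} := by
  have hM' : (2 : ℝ) ≤ M := by exact_mod_cast hM
  set L := Real.logb 2 M with hL
  have hL1 : 1 ≤ L := by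
    rw [hL, Real.le_logb_iff_rpow_le (by norm_num) (by linarith)]
    simpa using hM'
  -- `2 * L + 1` is the binary logarithm of `2 * M ^ 2`.
  set d := ⌈2 * L + 1⌉₊ with hd
  have hd1 : 2 * L + 1 ≤ d := Nat.le_ceil _
  have hd2 : (d : ℝ) ≤ 4 * L := by
    have := Nat.ceil_lt_add_one (a := 2 * L + 1) (by linarith)
    linarith
  refine ⟨d + 2, by push_cast; linarith, ?_⟩
  have hpow : 2 * (M : ℝ) ^ 2 ≤ 2 ^ d := by
    have h2 : (2 : ℝ) ^ (2 * L + 1) ≤ 2 ^ (d : ℝ) :=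
      Real.rpow_le_rpow_of_exponent_le (by norm_num) hd1
    rw [Real.rpow_add (by norm_num), mul_comm 2 L, Real.rpow_mul (by norm_num),
      hL, Real.rpow_logb (by norm_num) (by norm_num) (by linarith), Real.rpow_natCast] at h2
    norm_num at h2
    linarith
  have h1 := uniformProb_not_fitsAtDepth_le (M := M) hN hpow
  rw [uniformProb_compl] at h1
  rw [drawLaw_real_eq_uniformProb]
  suffices h : ((1 : ℝ) / 2) ^ (N / d) ≤
      2 * ((M : ℝ) ^ 2 * (2 : ℝ) ^ (-(1 / 4 * (N : ℝ) / L))) by linarith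
  have hd0 : (0 : ℝ) < d := by linarith
  -- Rounding down loses at most 1 in the exponent, which gives the constant `K = 2`.
  have h3 : (N : ℝ) / d ≤ (N / d : ℕ) + 1 := (Nat.lt_floor_add_one _).le.trans
    (by rw [Nat.floor_div_eq_div])
  have h4 : 1 / 4 * (N : ℝ) / L ≤ (N : ℝ) / d := by
    rw [div_le_div_iff₀ (by linarith) hd0]
    nlinarith [(Nat.cast_nonneg N : (0 : ℝ) ≤ N)]
  calc ((1 : ℝ) / 2) ^ (N / d) = 2 ^ (-((N / d : ℕ) : ℝ)) := by
        rw [Real.rpow_neg (by norm_num), Real.rpow_natCast]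
        simp
    _ ≤ 2 ^ (1 + -(1 / 4 * (N : ℝ) / L)) :=
        Real.rpow_le_rpow_of_exponent_le (by norm_num) (by linarith)
    _ = 2 * (1 * (2 : ℝ) ^ (-(1 / 4 * (N : ℝ) / L))) := by
        rw [Real.rpow_add (by norm_num)]
        simp
    _ ≤ _ := by
        gcongr
        nlinarith

end NonadaptiveSeparation

/-! ### Part (b): adaptive balanced splits. -/

section BalancedSplits

variable {M q : ℕ}

/-- In at most `j` rounds of splitting, the `l`-th round by columns of `f l`, the index set `I` can
be divided into parts of at most `n` elements. -/
def SplitsInto (n : ℕ) : (j : ℕ) → (Fin j → Fin q → Fin M → Bool) → Finset (Fin M) → Prop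
  | 0, _, I => I.card ≤ n
  | j + 1, f, I => I.card ≤ n ∨ ∃ i,
      SplitsInto n j (fun l => f l.succ) (I.filter (f 0 i · = true)) ∧
      SplitsInto n j (fun l => f l.succ) (I.filter (f 0 i · = false))

theorem SplitsInto.treeRealizable {N n : ℕ} (S : Fin M → Assortment N) (j : ℕ) :
    ∀ (e : Fin j → Fin q → Fin N) (I : Finset (Fin M)),
      SplitsInto (n + 1) j (fun g i m => decide (e g i ∈ S m)) I →
        TreeRealizable (I.image S) (j + n + 2) := by
  induction j with
  | zero =>
    intro e I h
    exact (TreeRealizable.of_card_le n _ (Finset.card_image_le.trans h)).mono (by omega)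
  | succ j ih =>
    rintro e I (h | ⟨i, hl, hr⟩)
    · exact (TreeRealizable.of_card_le n _ (Finset.card_image_le.trans h)).mono (by omega)
    · have h := TreeRealizable.of_split (A := I.image S) (e 0 i) (d := j + n + 2)
        (by
          rw [Finset.filter_image]
          simpa using ih (fun l => e l.succ) _ hl)
        (by
          rw [Finset.filter_image]
          simpa using ih (fun l => e l.succ) _ hr)
      exact h.mono (by omega)

/-- The column `c` divides `I` into two parts of at most `1 / r` times its size. -/
def BalancedOn (r : ℝ) (I : Finset (Fin M)) (c : Fin M → Bool) : Prop :=
  ((I.filter (c · = true)).card : ℝ) ≤ I.card / r ∧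
    ((I.filter (c · = false)).card : ℝ) ≤ I.card / r

/-- Conditioning on the first block fixes the two parts, while the later blocks stay uniform. The
failure bounds satisfy `p (j + 1) = δ + 2 * p j` with `p 0 = 0`. -/
theorem uniformProb_not_splitsInto_le {n : ℕ} {r δ : ℝ} (hr : 0 < r) (hδ0 : 0 ≤ δ)
    (hδ : ∀ I : Finset (Fin M), n < I.card →
      uniformProb (fun y : Fin q → Fin M → Bool => ∀ i, ¬ BalancedOn r I (y i)) ≤ δ) (j : ℕ) :
    ∀ I : Finset (Fin M), (I.card : ℝ) ≤ n * r ^ j →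
      uniformProb (fun f : Fin j → Fin q → Fin M → Bool => ¬ SplitsInto n j f I) ≤
        ((2 : ℝ) ^ j - 1) * δ := by
  classical
  induction j with
  | zero =>
    intro I hI
    have : I.card ≤ n := by simpa using hI
    simp [uniformProb, SplitsInto, this]
  | succ j ih =>
    intro I hI
    by_cases hn : I.card ≤ n
    · have hall : ∀ f : Fin (j + 1) → Fin q → Fin M → Bool, SplitsInto n (j + 1) f I :=
        fun f => Or.inl hn
      have : (1 : ℝ) ≤ 2 ^ (j + 1) := one_le_pow₀ (by norm_num)
      simp only [uniformProb, hall]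
      simpa using mul_nonneg (by linarith : (0 : ℝ) ≤ 2 ^ (j + 1) - 1) hδ0
    have hδI := hδ I (not_le.1 hn)
    rw [uniformProb_fin_succ]
    have hsec : ∀ y : Fin q → Fin M → Bool,
        uniformProb (fun f : Fin j → Fin q → Fin M → Bool =>
          ¬ SplitsInto n (j + 1) (Fin.cons y f : Fin (j + 1) → Fin q → Fin M → Bool) I) ≤
        (if ∀ i, ¬ BalancedOn r I (y i) then 1 else 0) + 2 * (((2 : ℝ) ^ j - 1) * δ) := by
      intro y
      have h1 : (0 : ℝ) ≤ ((2 : ℝ) ^ j - 1) * δ :=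
        mul_nonneg (sub_nonneg.2 (one_le_pow₀ (by norm_num))) hδ0
      split_ifs with hy
      · linarith [uniformProb_le_one (fun f : Fin j → Fin q → Fin M → Bool =>
          ¬ SplitsInto n (j + 1) (Fin.cons y f : Fin (j + 1) → Fin q → Fin M → Bool) I)]
      · push Not at hy
        obtain ⟨i, hi⟩ := hy
        have hdiv : (I.card : ℝ) / r ≤ n * r ^ j := by
          rw [div_le_iff₀ hr, mul_assoc, ← pow_succ]
          exact hI
        have hl := ih _ (hi.1.trans hdiv)
        have hr' := ih _ (hi.2.trans hdiv)
        refine (uniformProb_mono (E' := fun f => ¬ SplitsInto n j f (I.filter (y i · = true)) ∨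
          ¬ SplitsInto n j f (I.filter (y i · = false))) fun f hf => ?_).trans
          ((uniformProb_or_le _ _).trans (by linarith))
        by_contra! hc
        exact hf (Or.inr ⟨i, hc⟩)
    refine (Finset.expect_le_expect fun y _ => hsec y).trans ?_
    rw [Finset.expect_add_distrib, Fintype.expect_const]
    have h2 : (𝔼 y : Fin q → Fin M → Bool,
        if ∀ i, ¬ BalancedOn r I (y i) then (1 : ℝ) else 0) ≤ δ := by
      convert hδI using 1
      unfold uniformProb
      congr!
    rw [pow_succ]
    linarith

/-- The number of elements of `I` that `c` marks, minus the number of those that it does not. -/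
def imbalance (I : Finset (Fin M)) (c : Fin M → Bool) : ℝ :=
  ∑ m ∈ I, if c m = true then 1 else -1

theorem imbalance_eq (I : Finset (Fin M)) (c : Fin M → Bool) :
    imbalance I c = (I.filter (c · = true)).card - ((I.filter (c · = false)).card : ℝ) := by
  rw [imbalance, Finset.sum_ite]
  simp [sub_eq_add_neg]

theorem expect_exp_imbalance (I : Finset (Fin M)) (s : ℝ) :
    𝔼 c : Fin M → Bool, Real.exp (s * imbalance I c) = Real.cosh s ^ I.card := by
  have h : ∀ c : Fin M → Bool, Real.exp (s * imbalance I c) =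
      ∏ m, if m ∈ I then Real.exp (s * if c m = true then 1 else -1) else 1 := by
    intro c
    rw [imbalance, Finset.mul_sum, Real.exp_sum, Finset.prod_ite_mem, Finset.univ_inter]
  simp_rw [h]
  rw [expect_pi_prod (fun m (b : Bool) =>
    if m ∈ I then Real.exp (s * if b = true then 1 else -1) else 1)]
  have h2 : ∀ m, (𝔼 b : Bool, if m ∈ I then Real.exp (s * if b = true then 1 else -1) else 1) =
      if m ∈ I then Real.cosh s else 1 := by
    intro m
    split_ifs
    · rw [Fintype.expect_eq_sum_div_card, Real.cosh_eq]
      simp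
    · simp
  simp_rw [h2]
  simp

/-- Hoeffding's inequality for the two tails of the imbalance of a uniformly random column. -/
theorem uniformProb_lt_abs_imbalance_le (I : Finset (Fin M)) {t : ℝ} (ht : 0 ≤ t) :
    uniformProb (fun c : Fin M → Bool => t * I.card < |imbalance I c|) ≤
      2 * Real.exp (-(I.card * (t ^ 2 / 2))) := by
  classical
  have h1 : uniformProb (fun c : Fin M → Bool => t * I.card < |imbalance I c|) ≤
      𝔼 c : Fin M → Bool, (Real.exp (t * imbalance I c) + Real.exp (-t * imbalance I c)) *
        Real.exp (-(t ^ 2 * I.card)) := by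
    -- Chernoff bound with parameter `± t`: on the event one of the two exponentials is at least 1.
    refine Finset.expect_le_expect fun c _ => ?_
    split_ifs with hc
    · rw [add_mul, ← Real.exp_add, ← Real.exp_add]
      rcases lt_abs.1 hc with h | h
      · have : 1 ≤ Real.exp (t * imbalance I c + -(t ^ 2 * I.card)) :=
          Real.one_le_exp (by nlinarith)
        linarith [Real.exp_pos (-t * imbalance I c + -(t ^ 2 * I.card))]
      · have : 1 ≤ Real.exp (-t * imbalance I c + -(t ^ 2 * I.card)) :=
          Real.one_le_exp (by nlinarith)
        linarith [Real.exp_pos (t * imbalance I c + -(t ^ 2 * I.card))]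
    · positivity
  rw [← Finset.expect_mul, Finset.expect_add_distrib, expect_exp_imbalance, expect_exp_imbalance,
    Real.cosh_neg] at h1
  refine h1.trans ?_
  have h2 : Real.cosh t ^ I.card ≤ Real.exp (I.card * (t ^ 2 / 2)) := by
    rw [Real.exp_nat_mul]
    exact pow_le_pow_left₀ (Real.cosh_pos t).le (Real.cosh_le_exp_half_sq t) _
  calc (Real.cosh t ^ I.card + Real.cosh t ^ I.card) * Real.exp (-(t ^ 2 * I.card))
      ≤ (2 * Real.exp (I.card * (t ^ 2 / 2))) * Real.exp (-(t ^ 2 * I.card)) := by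
        gcongr
        linarith
    _ = _ := by
        rw [mul_assoc, ← Real.exp_add]
        ring_nf

theorem uniformProb_not_balancedOn_le (I : Finset (Fin M)) {ε : ℝ} (h0 : 0 < ε) (h1 : ε < 1) :
    uniformProb (fun c : Fin M → Bool => ¬ BalancedOn (2 - ε) I c) ≤
      2 * Real.exp (-(I.card * (ε ^ 2 / (2 * (2 - ε) ^ 2)))) := by
  have hr : 0 < 2 - ε := by linarith
  have h := uniformProb_lt_abs_imbalance_le I (t := ε / (2 - ε)) (by positivity)
  rw [div_pow, div_div, mul_comm _ (2 : ℝ)] at h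
  refine (uniformProb_mono fun c hc => ?_).trans h
  have hcard : ((I.filter (c · = true)).card : ℝ) + ((I.filter (c · = false)).card : ℝ) =
      I.card := by
    have := Finset.card_filter_add_card_filter_not (s := I) (c · = true)
    simp only [Bool.not_eq_true] at this
    exact_mod_cast this
  -- This is the imbalance when one part has size exactly `I.card / (2 - ε)`.
  have ht : ε / (2 - ε) * I.card = 2 * (I.card / (2 - ε)) - I.card := by
    field_simp
    ring
  rw [ht, imbalance_eq, lt_abs]
  rw [BalancedOn, not_and_or, not_le, not_le] at hc
  rcases hc with hc | hc
  · left; linarith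
  · right; linarith

theorem uniformProb_forall_not_balancedOn_le {n : ℕ} (I : Finset (Fin M)) (hI : n < I.card)
    {ε : ℝ} (h0 : 0 < ε) (h1 : ε < 1) :
    uniformProb (fun y : Fin q → Fin M → Bool => ∀ i, ¬ BalancedOn (2 - ε) I (y i)) ≤
      (2 : ℝ) ^ (-((q : ℝ) * (ε ^ 2 / (2 * (2 - ε) ^ 2) * n - 1))) := by
  set k := ε ^ 2 / (2 * (2 - ε) ^ 2) with hk
  have hk0 : 0 ≤ k := by positivity
  rw [uniformProb_forall (fun _ c => ¬ BalancedOn (2 - ε) I c), Finset.prod_const,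
    Finset.card_univ, Fintype.card_fin]
  have h2 : uniformProb (fun c : Fin M → Bool => ¬ BalancedOn (2 - ε) I c) ≤
      (2 : ℝ) ^ (-(k * n - 1)) := by
    refine (uniformProb_not_balancedOn_le I h0 h1).trans ?_
    rw [← hk, show -(k * n - 1) = 1 + -(k * n) by ring, Real.rpow_add (by norm_num), Real.rpow_one,
      Real.rpow_def_of_pos (by norm_num)]
    gcongr
    have hIn : (n : ℝ) ≤ I.card := by exact_mod_cast hI.le
    -- This weakens the Hoeffding bound from base `e` to base 2.
    have hlog : Real.log 2 ≤ 1 := by linarith [Real.log_two_lt_d9]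
    have hkn : 0 ≤ k * n := by positivity
    nlinarith [mul_le_mul_of_nonneg_left hIn hk0]
  refine (pow_le_pow_left₀ (uniformProb_nonneg _) h2 _).trans ?_
  rw [← Real.rpow_natCast, ← Real.rpow_mul (by norm_num)]
  apply le_of_eq
  congr 1
  ring

theorem le_mul_pow_splitLevels {M₀ : ℕ} {ε : ℝ} (hM₀ : 1 ≤ M₀) (hM : M₀ < M) (h1 : ε < 1) :
    (M : ℝ) ≤ M₀ * (2 - ε) ^ splitLevels M M₀ ε := by
  have hM₀' : (0 : ℝ) < M₀ := by exact_mod_cast hM₀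
  have hM' : (0 : ℝ) < M := by exact_mod_cast hM₀.trans hM.le
  rw [← div_le_iff₀' hM₀', ← Real.rpow_natCast,
    ← Real.logb_le_iff_le_rpow (by linarith) (by positivity)]
  exact Nat.le_ceil _

theorem drawLaw_not_fitsAtDepth_le (N M M₀ : ℕ) (ε : ℝ) (hN : 1 ≤ N) (hM₀ : 1 ≤ M₀) (hM : M₀ < M)
    (h0 : 0 < ε) (h1 : ε < 1) (M' : ℕ) (hM' : M' ≤ M) :
    (drawLaw N M').real {S | ¬ FitsAtDepth S (splitLevels M M₀ ε + M₀ + 1)} ≤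
      ((2 : ℝ) ^ splitLevels M M₀ ε - 1) *
        (2 : ℝ) ^ (-(((N / splitLevels M M₀ ε : ℕ) : ℝ) *
          (ε ^ 2 / (2 * (2 - ε) ^ 2) * (M₀ : ℝ) - 1))) := by
  -- A part of `n + 1` assortments is finished at depth `n + 2 = M₀ + 1`.
  obtain ⟨n, rfl⟩ : ∃ n, M₀ = n + 1 := ⟨M₀ - 1, by omega⟩
  have hle := le_mul_pow_splitLevels hM₀ hM h1
  set j := splitLevels M (n + 1) ε
  have hj : j * (N / j) ≤ N := Nat.mul_div_le N j
  rw [drawLaw_real_eq_uniformProb N M' fun S => ¬ FitsAtDepth S (j + (n + 1) + 1)]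
  have hmono : uniformProb (fun S : Fin M' → Assortment N =>
      ¬ FitsAtDepth S (j + (n + 1) + 1)) ≤
      uniformProb (fun S : Fin M' → Assortment N =>
        ¬ SplitsInto (n + 1) j (blockColumns hj S) Finset.univ) := by
    refine uniformProb_mono fun S hS hsplit => hS ?_
    exact fitsAtDepth_of_treeRealizable hN S (hsplit.treeRealizable S j _ _)
  rw [uniformProb_blockColumns hj fun f => ¬ SplitsInto (n + 1) j f Finset.univ] at hmono
  refine hmono.trans (uniformProb_not_splitsInto_le (by linarith) (by positivity)
    (fun I hI => uniformProb_forall_not_balancedOn_le I hI h0 h1) j _ ?_)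
  rw [Finset.card_univ, Fintype.card_fin]
  exact le_trans (by exact_mod_cast hM') hle

end BalancedSplits

theorem theorem3 :
    (∃ C K D : ℝ, 0 < C ∧ 0 < K ∧ 0 < D ∧
      ∀ N M : ℕ, 1 ≤ N → 2 ≤ M →
        ∃ d : ℕ, (d : ℝ) ≤ D * Real.logb 2 M ∧
          1 - K * ((M : ℝ) ^ 2 * (2 : ℝ) ^ (-(C * (N : ℝ) / Real.logb 2 M))) ≤
            (drawLaw N M).real {S | FitsAtDepth S d}) ∧
    (∀ (N M M₀ : ℕ) (ε : ℝ), 1 ≤ N → 1 ≤ M₀ → M₀ < M → 0 < ε → ε < 1 →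
      ∀ (k : ℝ) (dbar q : ℕ), k = ε ^ 2 / (2 * (2 - ε) ^ 2) → dbar = splitLevels M M₀ ε →
        q = N / dbar →
        ∀ M' : ℕ, M' ≤ M →
          (drawLaw N M').real {S | ¬ FitsAtDepth S (dbar + M₀ + 1)} ≤
            ((2 : ℝ) ^ dbar - 1) * (2 : ℝ) ^ (-((q : ℝ) * (k * (M₀ : ℝ) - 1)))) := by
  refine ⟨⟨1 / 4, 2, 6, by norm_num, by norm_num, by norm_num,
    exists_fitsAtDepth_logarithmic⟩, ?_⟩
  rintro N M M₀ ε hN hM₀ hM h0 h1 k dbar q rfl rfl rfl M' hM'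
  exact drawLaw_not_fitsAtDepth_le N M M₀ ε hN hM₀ hM h0 h1 M' hM'
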